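/- For $p\in[0,1]$ let $g_p(t)=\frac1{t^2}\log\left[p e^{t(1-p)}+(1-p)e^{-tp}\right]$ for $t\ne0$ and $g_p(0)=\frac{p(1-p)}2$ (its limit at $0$), and let $g_{p_1,p_2}=g_{p_1}+g_{p_2}$. For $(p_1,p_2)\in(0,1)^2$ put $t^*_{p_1,p_2}=\log\left[\frac{1-p_1}{p_1}\cdot\frac{1-p_2}{p_2}\right]$, which is positive, zero or negative according as $p_1+p_2<1$, $=1$ or $>1$. A differentiable function $f:\mathbb R\to\mathbb R$ is called (strictly) unimodal if there is an $x$ such that $f'>0$ on $(-\infty,x)$ and $f'<0$ on $(x,\infty)$. Let $$A=\left\{(p_1,p_2)\in[0,1]^2:\ 2p_1p_2-p_1(2p_1-1)-p_2(2p_2-1)\ge0\right\},$$ and let $B$ consist of the two corners $(0,0)$, $(1,1)$ and of all $(p_1,p_2)\in(0,1)^2$ such that $$\left|\log\left(\frac{1-p_1}{p_1}\cdot\frac{1-p_2}{p_2}\right)\right|\le\frac{2\,|1-p_1-p_2|}{p_1(1-p_1)+p_2(1-p_2)}$$ and such that, if $p_1+p_2=1$, moreover $\frac{3-\sqrt3}6\le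 p_1\le\frac{3+\sqrt3}6$. Then $g_{p_1,p_2}'(t^*_{p_1,p_2})=0$ for all $(p_1,p_2)\in(0,1)^2$, and there is a set $C$ with $C\subseteq B\subseteq A\subseteq[0,1]^2$ such that the following hold. 1. Let $(p_1,p_2)\in[0,1]^2\setminus\{(0,0),(1,1)\}$. If $p_1+p_2\le1$, then $g_{p_1,p_2}'(t)>0$ for all $t<0$ if and only if $(p_1,p_2)\in A$. If $p_1+p_2\ge1$, then $g_{p_1,p_2}'(t)<0$ for all $t>0$ if and only if $(p_1,p_2)\in A$. 2. Let $(p_1,p_2)\in(0,1)^2$. If $p_1+p_2\le1$, then $g_{p_1,p_2}'(t)<0$ for all $t>t^*_{p_1,p_2}$ if and only if $(p_1,p_2)\in B$. If $p_1+p_2\ge1$, then $g_{p_1,p_2}'(t)>0$ for all $t<t^*_{p_1,p_2}$ if and only if $(p_1,p_2)\in B$. 3. Let $(p_1,p_2)\in(0,1)^2$. If $p_1+p_2<1$, then $g_{p_1,p_2}'(t)>0$ for all $0<t<t^*_{p_1,p_2}$ if and only if $(p_1,p_2)\in C$. If $p_1+p_2>1$, then $g_{p_1,p_2}'(t)<0$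 for all $t^*_{p_1,p_2}<t<0$ if and only if $(p_1,p_2)\in C$. In particular, for $(p_1,p_2)\in(0,1)^2$, the function $g_{p_1,p_2}$ is unimodal if and only if $(p_1,p_2)\in C$. -/

import Mathlib

open Set

noncomputable section

/-- The function `g_p(t) = t⁻² log (p e^{t(1-p)} + (1-p) e^{-tp})`, i.e. `t⁻²` times the logarithm
of the Laplace transform of a centred Bernoulli variable, with its removable singularity at `t = 0`
filled in by the limit `p (1 - p) / 2`. -/
def gOne (p t : ℝ) : ℝ :=
  if t = 0 then p * (1 - p) / 2
  else 1 / t ^ 2 * Real.log (p * Real.exp (t * (1 - p)) + (1 - p) * Real.exp (-(t * p)))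

/-- `g_{p₁,p₂} = g_{p₁} + g_{p₂}`. -/
def gTwo (p₁ p₂ t : ℝ) : ℝ := gOne p₁ t + gOne p₂ t

/-- `t* = log [ (1-p₁)/p₁ · (1-p₂)/p₂ ]`, meaningful for `0 < p₁, p₂ < 1`. -/
def tStar (p₁ p₂ : ℝ) : ℝ := Real.log ((1 - p₁) / p₁ * ((1 - p₂) / p₂))

/-- A differentiable function is (strictly) unimodal if its derivative is positive to the left of
some point and negative to the right of it. -/
def StrictlyUnimodal (f : ℝ → ℝ) : Prop :=
  Differentiable ℝ f ∧ ∃ x : ℝ, (∀ t < x, 0 < deriv f t) ∧ ∀ t > x, deriv f t < 0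

/-- The set `A`. -/
def setA : Set (ℝ × ℝ) :=
  {p | p ∈ Icc (0 : ℝ) 1 ×ˢ Icc (0 : ℝ) 1 ∧
    0 ≤ 2 * p.1 * p.2 - p.1 * (2 * p.1 - 1) - p.2 * (2 * p.2 - 1)}

/-- The set `B`. The inequality is trivially true on the antidiagonal `p₁ + p₂ = 1`, where it is
supplemented by `p₁ ∈ [p⁻, p⁺]` with `p^± = (3 ± √3)/6`; the two corners are the limit points of the
set on the boundary of the square, where the inequality itself makes no sense. -/
def setB : Set (ℝ × ℝ) :=
  {p | p ∈ Ioo (0 : ℝ) 1 ×ˢ Ioo (0 : ℝ) 1 ∧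
    |tStar p.1 p.2| ≤ 2 * |1 - p.1 - p.2| / (p.1 * (1 - p.1) + p.2 * (1 - p.2)) ∧
    (p.1 + p.2 = 1 → p.1 ∈ Icc ((3 - √3) / 6) ((3 + √3) / 6))} ∪ {(0, 0), (1, 1)}

end

/-! Write Φ for `cgf`, so that g = Φ/t² and g' = E/t³ away from 0, with E = tΦ' - 2Φ (`excess`).
Since E(0) = E'(0) = 0 and E'' = tΦ''', signs of g' follow from signs of Φ'''.

Each summand of Φ'' is a logistic density centred at a log-odds, so Φ'' is even about t*/2. At t*/2
+ x it depends only on cosh x, and Φ''' is sinh x times `shapeFactor` over a positive quantity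
(`cgf₃_eq`). As `shapeFactor` decreases in |x|, its sign at x = t*/2 governs Φ''' outside [0, t*];
in the open square that sign is the condition defining A (`mem_setA_iff_shapeFactor`).

At t* all values are explicit: E(t*) = 0, and for p₁ + p₂ < 1 the inequality of B says E'(t*) ≤ 0.
This is necessary for E < 0 beyond t*, and sufficient because it forces membership in A
(`shapeFactor_neg_of_excess₁_nonpos`), hence Φ''' < 0 there. Likewise g' > 0 on (0, t*) forces
E'(t*) ≤ 0. So the condition on the middle interval implies those on both outer rays and is
equivalent to unimodality, whose mode must be the critical point t*.

The half p₁ + p₂ ≥ 1 follows by the reflection (p₁, p₂, t) ↦ (1 - p₁, 1 - p₂, -t). -/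

open Filter Topology

/-! ### Sign lemmas from second derivatives -/

/-- A function that vanishes at `a`, does not increase there and is strictly concave on `(a, b)` is
negative on `(a, b)`. -/
theorem neg_right_of_second_deriv_neg {u u' u'' : ℝ → ℝ} {a b : ℝ}
    (h₁ : ∀ t, HasDerivAt u (u' t) t) (h₂ : ∀ t, HasDerivAt u' (u'' t) t)
    (hu : u a ≤ 0) (hu' : u' a ≤ 0) (hn : ∀ t ∈ Ioo a b, u'' t < 0) :
    ∀ t ∈ Ioo a b, u t < 0 := by
  have key : ∀ {v v' : ℝ → ℝ}, (∀ t, HasDerivAt v (v' t) t) → v a ≤ 0 →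
      (∀ t ∈ Ioo a b, v' t < 0) → ∀ t ∈ Ioo a b, v t < 0 := by
    intro v v' hv hva hneg t ht
    have hanti : StrictAntiOn v (Icc a t) := by
      refine strictAntiOn_of_deriv_neg (convex_Icc a t)
        (fun x _ => (hv x).continuousAt.continuousWithinAt) fun x hx => ?_
      rw [interior_Icc] at hx
      rw [(hv x).deriv]
      exact hneg x ⟨hx.1, hx.2.trans ht.2⟩
    exact (hanti (left_mem_Icc.2 ht.1.le) (right_mem_Icc.2 ht.1.le) ht.1).trans_le hva
  exact key h₁ hu (key h₂ hu' hn)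

theorem pos_right_of_second_deriv_pos {u u' u'' : ℝ → ℝ} {a b : ℝ}
    (h₁ : ∀ t, HasDerivAt u (u' t) t) (h₂ : ∀ t, HasDerivAt u' (u'' t) t)
    (hu : 0 ≤ u a) (hu' : 0 ≤ u' a) (hn : ∀ t ∈ Ioo a b, 0 < u'' t) :
    ∀ t ∈ Ioo a b, 0 < u t := fun t ht => by
  have := neg_right_of_second_deriv_neg (u := fun t => -u t) (fun t => (h₁ t).fun_neg)
    (fun t => (h₂ t).fun_neg) (by simpa using hu) (by simpa using hu')
    (fun t ht => by simpa using hn t ht) t ht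
  simpa using this

theorem neg_left_of_second_deriv_neg {u u' u'' : ℝ → ℝ} {a b : ℝ}
    (h₁ : ∀ t, HasDerivAt u (u' t) t) (h₂ : ∀ t, HasDerivAt u' (u'' t) t)
    (hu : u a ≤ 0) (hu' : 0 ≤ u' a) (hn : ∀ t ∈ Ioo b a, u'' t < 0) :
    ∀ t ∈ Ioo b a, u t < 0 := fun t ht => by
  have h₁' : ∀ t, HasDerivAt (fun t => u (-t)) (-u' (-t)) t := fun t => by
    simpa [Function.comp_def] using (h₁ (-t)).scomp t (hasDerivAt_neg t)
  have h₂' : ∀ t, HasDerivAt (fun t => -u' (-t)) (u'' (-t)) t := fun t => by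
    simpa [Function.comp_def] using ((h₂ (-t)).scomp t (hasDerivAt_neg t)).fun_neg
  have := neg_right_of_second_deriv_neg (a := -a) (b := -b) h₁' h₂' (by simpa using hu)
    (by simpa using hu') (fun t ht => hn _ ⟨by linarith [ht.2], by linarith [ht.1]⟩) (-t)
    ⟨by linarith [ht.2], by linarith [ht.1]⟩
  simpa using this

theorem pos_left_of_second_deriv_pos {u u' u'' : ℝ → ℝ} {a b : ℝ}
    (h₁ : ∀ t, HasDerivAt u (u' t) t) (h₂ : ∀ t, HasDerivAt u' (u'' t) t)
    (hu : 0 ≤ u a) (hu' : u' a ≤ 0) (hn : ∀ t ∈ Ioo b a, 0 < u'' t) :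
    ∀ t ∈ Ioo b a, 0 < u t := fun t ht => by
  have := neg_left_of_second_deriv_neg (u := fun t => -u t) (fun t => (h₁ t).fun_neg)
    (fun t => (h₂ t).fun_neg) (by simpa using hu) (by simpa using hu')
    (fun t ht => by simpa using hn t ht) t ht
  simpa using this

/-- If `u` vanishes at `a` and is negative to the right of `a` then its derivative at `a` is
nonpositive. -/
theorem deriv_nonpos_of_neg_right {u : ℝ → ℝ} {u' a : ℝ} (h : HasDerivAt u u' a)
    (hu : u a = 0) (hn : ∀ t > a, u t < 0) : u' ≤ 0 := by
  have hs := h.tendsto_slope.mono_left (nhdsGT_le_nhdsNE a)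
  refine le_of_tendsto hs ?_
  filter_upwards [self_mem_nhdsWithin] with t ht
  rw [slope_def_field, hu, sub_zero]
  exact div_nonpos_of_nonpos_of_nonneg (hn t ht).le (sub_nonneg.2 (le_of_lt ht))

theorem deriv_nonpos_of_pos_left {u : ℝ → ℝ} {u' a b : ℝ} (h : HasDerivAt u u' a)
    (hu : u a = 0) (hb : b < a) (hn : ∀ t ∈ Ioo b a, 0 < u t) : u' ≤ 0 := by
  have hs := h.tendsto_slope.mono_left (nhdsLT_le_nhdsNE a)
  refine le_of_tendsto hs ?_
  filter_upwards [Ioo_mem_nhdsLT hb] with t ht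
  rw [slope_def_field, hu, sub_zero]
  exact div_nonpos_of_nonneg_of_nonpos (hn t ht).le (sub_nonpos.2 ht.2.le)

/-! ### Dividing by `t ^ 2` -/

/-- Away from `0`, the derivative of `F₀ t / t ^ 2`. -/
theorem hasDerivAt_div_sq {F₀ F₁ g : ℝ → ℝ} (h₀ : ∀ t, HasDerivAt F₀ (F₁ t) t)
    (hg : ∀ t ≠ 0, g t = F₀ t / t ^ 2) {t : ℝ} (ht : t ≠ 0) :
    HasDerivAt g ((t * F₁ t - 2 * F₀ t) / t ^ 3) t := by
  have h := (h₀ t).fun_div (hasDerivAt_pow 2 t) (pow_ne_zero 2 ht)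
  have h' := h.congr_of_eventuallyEq (f₁ := g)
    ((eventually_ne_nhds ht).mono fun s hs => hg s hs)
  refine h'.congr_deriv ?_
  field_simp
  push_cast
  ring

theorem hasDerivAt_excess {F₀ F₁ F₂ : ℝ → ℝ} (h₀ : ∀ t, HasDerivAt F₀ (F₁ t) t)
    (h₁ : ∀ t, HasDerivAt F₁ (F₂ t) t) (t : ℝ) :
    HasDerivAt (fun t => t * F₁ t - 2 * F₀ t) (t * F₂ t - F₁ t) t := by
  have := ((hasDerivAt_id' t).fun_mul (h₁ t)).fun_sub ((h₀ t).const_mul 2)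
  refine this.congr_deriv ?_
  ring

theorem hasDerivAt_excess' {F₁ F₂ F₃ : ℝ → ℝ} (h₁ : ∀ t, HasDerivAt F₁ (F₂ t) t)
    (h₂ : ∀ t, HasDerivAt F₂ (F₃ t) t) (t : ℝ) :
    HasDerivAt (fun t => t * F₂ t - F₁ t) (t * F₃ t) t := by
  have := ((hasDerivAt_id' t).fun_mul (h₂ t)).fun_sub (h₁ t)
  refine this.congr_deriv ?_
  ring

/-- At `0`, the function `F₀ t / t ^ 2` with its removable singularity filled in has derivative
`F₀'''(0) / 6`. -/
theorem hasDerivAt_div_sq_zero {F₀ F₁ F₂ F₃ g : ℝ → ℝ} (h₀ : ∀ t, HasDerivAt F₀ (F₁ t) t)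
    (h₁ : ∀ t, HasDerivAt F₁ (F₂ t) t) (h₂ : ∀ t, HasDerivAt F₂ (F₃ t) t)
    (h₃ : ContinuousAt F₃ 0) (z₀ : F₀ 0 = 0) (z₁ : F₁ 0 = 0)
    (hg : ∀ t ≠ 0, g t = F₀ t / t ^ 2) (hg0 : g 0 = F₂ 0 / 2) :
    HasDerivAt g (F₃ 0 / 6) 0 := by
  have ne : ∀ᶠ t : ℝ in 𝓝[≠] 0, t ≠ 0 := self_mem_nhdsWithin
  have lim0 : ∀ {f : ℝ → ℝ}, ContinuousAt f 0 → f 0 = 0 → Tendsto f (𝓝[≠] 0) (𝓝 0) :=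
    fun hf h0 => (h0 ▸ hf.tendsto).mono_left nhdsWithin_le_nhds
  have hpow : ∀ (n : ℕ), n ≠ 0 → Tendsto (fun t : ℝ => t ^ n) (𝓝[≠] 0) (𝓝 0) := fun n hn =>
    lim0 (by fun_prop) (by simp [hn])
  -- One use of l'Hôpital reduces F₀/t² to F₁/(2t), half the slope of F₁ at 0.
  have hcont : ContinuousAt g 0 := by
    rw [continuousAt_iff_punctured_nhds, hg0]
    have l1 : Tendsto (fun t => F₁ t / (2 * t)) (𝓝[≠] 0) (𝓝 (F₂ 0 / 2)) := by
      have := (h₁ 0).tendsto_slope.div_const 2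
      refine this.congr' (ne.mono fun t ht => ?_)
      rw [slope_def_field, z₁]
      field_simp
      ring
    have l2 : Tendsto (fun t => F₀ t / t ^ 2) (𝓝[≠] 0) (𝓝 (F₂ 0 / 2)) := by
      refine HasDerivAt.lhopital_zero_nhdsNE (f' := F₁) (g' := fun t => 2 * t)
        (Eventually.of_forall h₀) (Eventually.of_forall fun t => ?_)
        (ne.mono fun t ht => by simpa using ht) (lim0 (h₀ 0).continuousAt z₀)
        (hpow 2 two_ne_zero) l1
      simpa using hasDerivAt_pow 2 t
    exact l2.congr' (ne.mono fun t ht => (hg t ht).symm)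
  -- Three uses of l'Hôpital, proved innermost first: the quotient ends as t F₃/(6t).
  have lim : Tendsto (fun t => (t * F₁ t - 2 * F₀ t) / t ^ 3) (𝓝[≠] 0) (𝓝 (F₃ 0 / 6)) := by
    have l3 : Tendsto (fun t => (t * F₃ t) / (6 * t)) (𝓝[≠] 0) (𝓝 (F₃ 0 / 6)) := by
      refine ((h₃.tendsto.mono_left nhdsWithin_le_nhds).div_const 6).congr'
        (ne.mono fun t ht => ?_)
      field_simp
    have l4 : Tendsto (fun t => (t * F₂ t - F₁ t) / (3 * t ^ 2)) (𝓝[≠] 0) (𝓝 (F₃ 0 / 6)) := by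
      refine HasDerivAt.lhopital_zero_nhdsNE (f' := fun t => t * F₃ t) (g' := fun t => 6 * t)
        (Eventually.of_forall (hasDerivAt_excess' h₁ h₂)) (Eventually.of_forall fun t => ?_)
        (ne.mono fun t ht => by simpa using ht)
        (lim0 (hasDerivAt_excess' h₁ h₂ 0).continuousAt (by simp [z₁]))
        (by simpa using (hpow 2 two_ne_zero).const_mul 3) l3
      refine ((hasDerivAt_pow 2 t).const_mul 3).congr_deriv ?_
      push_cast
      ring
    refine HasDerivAt.lhopital_zero_nhdsNE (f' := fun t => t * F₂ t - F₁ t)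
      (g' := fun t => 3 * t ^ 2)
      (Eventually.of_forall (hasDerivAt_excess h₀ h₁)) (Eventually.of_forall fun t => ?_)
      (ne.mono fun t ht => by simpa using ht)
      (lim0 (hasDerivAt_excess h₀ h₁ 0).continuousAt (by simp [z₀]))
      (hpow 3 three_ne_zero) l4
    simpa using hasDerivAt_pow 3 t
  -- With its limit inserted at 0, the punctured derivative is continuous there, so
  -- differentiability of the continuous function g extends across 0.
  have hd : ContinuousAt (Function.update (fun t => (t * F₁ t - 2 * F₀ t) / t ^ 3) 0 (F₃ 0 / 6))
      0 := continuousAt_update_same.2 lim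
  have := hasDerivAt_of_hasDerivAt_of_ne
    (g := Function.update (fun t => (t * F₁ t - 2 * F₀ t) / t ^ 3) 0 (F₃ 0 / 6))
    (fun t ht => by simpa [Function.update_of_ne ht] using hasDerivAt_div_sq h₀ hg ht) hcont hd
  simpa using this

noncomputable section

/-! ### The cumulant generating function of a centred Bernoulli variable -/

/-- The cumulant generating function of a centred Bernoulli variable. -/
def bernCgf (p t : ℝ) : ℝ := Real.log (p * Real.exp t + (1 - p)) - p * t

/-- First derivative of `bernCgf`. -/
def bernCgf₁ (p t : ℝ) : ℝ := p * Real.exp t / (p * Real.exp t + (1 - p)) - p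

/-- Second derivative of `bernCgf`. -/
def bernCgf₂ (p t : ℝ) : ℝ := p * (1 - p) * Real.exp t / (p * Real.exp t + (1 - p)) ^ 2

/-- Third derivative of `bernCgf`. -/
def bernCgf₃ (p t : ℝ) : ℝ :=
  p * (1 - p) * Real.exp t * (1 - p - p * Real.exp t) / (p * Real.exp t + (1 - p)) ^ 3

section

variable {p : ℝ}

theorem bern_weight_pos (hp : p ∈ Icc (0 : ℝ) 1) (t : ℝ) : 0 < p * Real.exp t + (1 - p) := by
  have := Real.exp_pos t
  rcases hp.1.eq_or_lt with rfl | h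
  · simp
  · have := mul_pos h this
    linarith [hp.2]

theorem hasDerivAt_bern_weight (t : ℝ) :
    HasDerivAt (fun t => p * Real.exp t + (1 - p)) (p * Real.exp t) t :=
  ((Real.hasDerivAt_exp t).const_mul p).add_const _

theorem hasDerivAt_bernCgf (hp : p ∈ Icc (0 : ℝ) 1) (t : ℝ) :
    HasDerivAt (bernCgf p) (bernCgf₁ p t) t := by
  have := ((hasDerivAt_bern_weight t).log (bern_weight_pos hp t).ne').fun_sub
    ((hasDerivAt_id' t).const_mul p)
  exact this.congr_deriv (by rw [bernCgf₁, mul_one])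

theorem hasDerivAt_bernCgf₁ (hp : p ∈ Icc (0 : ℝ) 1) (t : ℝ) :
    HasDerivAt (bernCgf₁ p) (bernCgf₂ p t) t := by
  have hw := (bern_weight_pos hp t).ne'
  have := (((Real.hasDerivAt_exp t).const_mul p).fun_div (hasDerivAt_bern_weight t) hw).sub_const p
  refine this.congr_deriv ?_
  rw [bernCgf₂]
  congr 1
  ring

theorem hasDerivAt_bernCgf₂ (hp : p ∈ Icc (0 : ℝ) 1) (t : ℝ) :
    HasDerivAt (bernCgf₂ p) (bernCgf₃ p t) t := by
  have hw := (bern_weight_pos hp t).ne'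
  have := ((Real.hasDerivAt_exp t).const_mul (p * (1 - p))).fun_div
    ((hasDerivAt_bern_weight (p := p) t).fun_pow 2) (pow_ne_zero 2 hw)
  refine this.congr_deriv ?_
  rw [bernCgf₃]
  field_simp
  push_cast
  ring

theorem continuous_bernCgf₃ (hp : p ∈ Icc (0 : ℝ) 1) : Continuous (bernCgf₃ p) := by
  unfold bernCgf₃
  exact Continuous.div (by fun_prop) (by fun_prop) fun t => pow_ne_zero 3 (bern_weight_pos hp t).ne'

/-- Factoring e^{-tp} out of the Laplace transform splits off the linear term -pt. -/
theorem gOne_eq (hp : p ∈ Icc (0 : ℝ) 1) {t : ℝ} (ht : t ≠ 0) :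
    gOne p t = bernCgf p t / t ^ 2 := by
  have hw := bern_weight_pos hp t
  have : p * Real.exp (t * (1 - p)) + (1 - p) * Real.exp (-(t * p))
      = (p * Real.exp t + (1 - p)) * Real.exp (-(t * p)) := by
    rw [show t * (1 - p) = t + -(t * p) by ring, Real.exp_add]
    ring
  rw [gOne, if_neg ht, this, Real.log_mul hw.ne' (Real.exp_pos _).ne', Real.log_exp, bernCgf]
  ring

end

/-! ### The sum of two cumulant generating functions -/

/-- Cumulant generating function of the sum of two independent centred Bernoulli variables. -/
def cgf (p₁ p₂ t : ℝ) : ℝ := bernCgf p₁ t + bernCgf p₂ t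

/-- First derivative of `cgf`. -/
def cgf₁ (p₁ p₂ t : ℝ) : ℝ := bernCgf₁ p₁ t + bernCgf₁ p₂ t

/-- Second derivative of `cgf`. -/
def cgf₂ (p₁ p₂ t : ℝ) : ℝ := bernCgf₂ p₁ t + bernCgf₂ p₂ t

/-- Third derivative of `cgf`. -/
def cgf₃ (p₁ p₂ t : ℝ) : ℝ := bernCgf₃ p₁ t + bernCgf₃ p₂ t

/-- The numerator `t Φ'(t) - 2 Φ(t)` of the derivative of `gTwo`, where `Φ` is `cgf`. -/
def excess (p₁ p₂ t : ℝ) : ℝ := t * cgf₁ p₁ p₂ t - 2 * cgf p₁ p₂ t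

/-- First derivative of `excess`. -/
def excess₁ (p₁ p₂ t : ℝ) : ℝ := t * cgf₂ p₁ p₂ t - cgf₁ p₁ p₂ t

section

variable {p₁ p₂ : ℝ}

theorem hasDerivAt_cgf (h₁ : p₁ ∈ Icc (0 : ℝ) 1) (h₂ : p₂ ∈ Icc (0 : ℝ) 1) (t : ℝ) :
    HasDerivAt (cgf p₁ p₂) (cgf₁ p₁ p₂ t) t :=
  (hasDerivAt_bernCgf h₁ t).add (hasDerivAt_bernCgf h₂ t)

theorem hasDerivAt_cgf₁ (h₁ : p₁ ∈ Icc (0 : ℝ) 1) (h₂ : p₂ ∈ Icc (0 : ℝ) 1) (t : ℝ) :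
    HasDerivAt (cgf₁ p₁ p₂) (cgf₂ p₁ p₂ t) t :=
  (hasDerivAt_bernCgf₁ h₁ t).add (hasDerivAt_bernCgf₁ h₂ t)

theorem hasDerivAt_cgf₂ (h₁ : p₁ ∈ Icc (0 : ℝ) 1) (h₂ : p₂ ∈ Icc (0 : ℝ) 1) (t : ℝ) :
    HasDerivAt (cgf₂ p₁ p₂) (cgf₃ p₁ p₂ t) t :=
  (hasDerivAt_bernCgf₂ h₁ t).add (hasDerivAt_bernCgf₂ h₂ t)

theorem hasDerivAt_excess_cgf (h₁ : p₁ ∈ Icc (0 : ℝ) 1) (h₂ : p₂ ∈ Icc (0 : ℝ) 1) (t : ℝ) :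
    HasDerivAt (excess p₁ p₂) (excess₁ p₁ p₂ t) t :=
  hasDerivAt_excess (hasDerivAt_cgf h₁ h₂) (hasDerivAt_cgf₁ h₁ h₂) t

theorem hasDerivAt_excess₁ (h₁ : p₁ ∈ Icc (0 : ℝ) 1) (h₂ : p₂ ∈ Icc (0 : ℝ) 1) (t : ℝ) :
    HasDerivAt (excess₁ p₁ p₂) (t * cgf₃ p₁ p₂ t) t :=
  hasDerivAt_excess' (hasDerivAt_cgf₁ h₁ h₂) (hasDerivAt_cgf₂ h₁ h₂) t

theorem continuous_cgf₃ (h₁ : p₁ ∈ Icc (0 : ℝ) 1) (h₂ : p₂ ∈ Icc (0 : ℝ) 1) :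
    Continuous (cgf₃ p₁ p₂) :=
  (continuous_bernCgf₃ h₁).add (continuous_bernCgf₃ h₂)

theorem cgf_zero : cgf p₁ p₂ 0 = 0 := by simp [cgf, bernCgf]

theorem cgf₁_zero : cgf₁ p₁ p₂ 0 = 0 := by simp [cgf₁, bernCgf₁]

theorem cgf₂_zero : cgf₂ p₁ p₂ 0 = p₁ * (1 - p₁) + p₂ * (1 - p₂) := by simp [cgf₂, bernCgf₂]

theorem excess_zero : excess p₁ p₂ 0 = 0 := by simp [excess, cgf_zero]

theorem excess₁_zero : excess₁ p₁ p₂ 0 = 0 := by simp [excess₁, cgf₁_zero]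

theorem gTwo_eq (h₁ : p₁ ∈ Icc (0 : ℝ) 1) (h₂ : p₂ ∈ Icc (0 : ℝ) 1) {t : ℝ} (ht : t ≠ 0) :
    gTwo p₁ p₂ t = cgf p₁ p₂ t / t ^ 2 := by
  rw [gTwo, gOne_eq h₁ ht, gOne_eq h₂ ht, cgf, add_div]

theorem hasDerivAt_gTwo (h₁ : p₁ ∈ Icc (0 : ℝ) 1) (h₂ : p₂ ∈ Icc (0 : ℝ) 1) {t : ℝ}
    (ht : t ≠ 0) : HasDerivAt (gTwo p₁ p₂) (excess p₁ p₂ t / t ^ 3) t :=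
  hasDerivAt_div_sq (hasDerivAt_cgf h₁ h₂) (fun _ hs => gTwo_eq h₁ h₂ hs) ht

theorem hasDerivAt_gTwo_zero (h₁ : p₁ ∈ Icc (0 : ℝ) 1) (h₂ : p₂ ∈ Icc (0 : ℝ) 1) :
    HasDerivAt (gTwo p₁ p₂) (cgf₃ p₁ p₂ 0 / 6) 0 :=
  hasDerivAt_div_sq_zero (hasDerivAt_cgf h₁ h₂) (hasDerivAt_cgf₁ h₁ h₂) (hasDerivAt_cgf₂ h₁ h₂)
    (continuous_cgf₃ h₁ h₂).continuousAt cgf_zero cgf₁_zero (fun _ ht => gTwo_eq h₁ h₂ ht)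
    (by rw [cgf₂_zero, gTwo, gOne, gOne, if_pos rfl, if_pos rfl]; ring)

theorem differentiable_gTwo (h₁ : p₁ ∈ Icc (0 : ℝ) 1) (h₂ : p₂ ∈ Icc (0 : ℝ) 1) :
    Differentiable ℝ (gTwo p₁ p₂) := fun t => by
  rcases eq_or_ne t 0 with rfl | ht
  · exact (hasDerivAt_gTwo_zero h₁ h₂).differentiableAt
  · exact (hasDerivAt_gTwo h₁ h₂ ht).differentiableAt

/-! ### Signs of the derivative through `excess` -/

section

variable (h₁ : p₁ ∈ Icc (0 : ℝ) 1) (h₂ : p₂ ∈ Icc (0 : ℝ) 1) {t : ℝ}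
include h₁ h₂

theorem deriv_gTwo_pos_iff_of_neg (ht : t < 0) :
    0 < deriv (gTwo p₁ p₂) t ↔ excess p₁ p₂ t < 0 := by
  have h3 : t ^ 3 < 0 := Odd.pow_neg (by decide) ht
  rw [(hasDerivAt_gTwo h₁ h₂ ht.ne).deriv]
  constructor
  · intro h
    by_contra! h'
    exact absurd h (not_lt.2 (div_nonpos_of_nonneg_of_nonpos h' h3.le))
  · exact fun h => div_pos_of_neg_of_neg h h3

theorem deriv_gTwo_pos_iff_of_pos (ht : 0 < t) :
    0 < deriv (gTwo p₁ p₂) t ↔ 0 < excess p₁ p₂ t := by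
  rw [(hasDerivAt_gTwo h₁ h₂ ht.ne').deriv]
  exact div_pos_iff_of_pos_right (by positivity)

theorem deriv_gTwo_neg_iff_of_pos (ht : 0 < t) :
    deriv (gTwo p₁ p₂) t < 0 ↔ excess p₁ p₂ t < 0 := by
  rw [(hasDerivAt_gTwo h₁ h₂ ht.ne').deriv]
  have h3 : 0 < t ^ 3 := by positivity
  rw [div_lt_iff₀ h3, zero_mul]

theorem excess_neg_of_cgf₃_pos_left {b : ℝ} (h : ∀ t ∈ Ioo b 0, 0 < cgf₃ p₁ p₂ t) :
    ∀ t ∈ Ioo b 0, excess p₁ p₂ t < 0 :=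
  neg_left_of_second_deriv_neg (hasDerivAt_excess_cgf h₁ h₂) (hasDerivAt_excess₁ h₁ h₂)
    excess_zero.le excess₁_zero.ge fun t ht => mul_neg_of_neg_of_pos ht.2 (h t ht)

theorem excess_pos_of_cgf₃_neg_left {b : ℝ} (h : ∀ t ∈ Ioo b 0, cgf₃ p₁ p₂ t < 0) :
    ∀ t ∈ Ioo b 0, 0 < excess p₁ p₂ t :=
  pos_left_of_second_deriv_pos (hasDerivAt_excess_cgf h₁ h₂) (hasDerivAt_excess₁ h₁ h₂)
    excess_zero.ge excess₁_zero.le fun t ht => mul_pos_of_neg_of_neg ht.2 (h t ht)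

theorem excess_pos_of_cgf₃_pos_right {b : ℝ} (h : ∀ t ∈ Ioo 0 b, 0 < cgf₃ p₁ p₂ t) :
    ∀ t ∈ Ioo 0 b, 0 < excess p₁ p₂ t :=
  pos_right_of_second_deriv_pos (hasDerivAt_excess_cgf h₁ h₂) (hasDerivAt_excess₁ h₁ h₂)
    excess_zero.ge excess₁_zero.ge fun t ht => mul_pos ht.1 (h t ht)

end

end

end

noncomputable section

/-! ### Hyperbolic form of the derivatives on the open square -/

/-- Half the difference of the two log-odds. -/
def halfGap (p₁ p₂ : ℝ) : ℝ := (Real.log ((1 - p₁) / p₁) - Real.log ((1 - p₂) / p₂)) / 2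

/-- The factor of the third derivative `cgf₃` at `tStar / 2 + x` that decides where `cgf₂` is
monotone. -/
def shapeFactor (p₁ p₂ x : ℝ) : ℝ :=
  Real.cosh (halfGap p₁ p₂) ^ 2 - 2 - Real.cosh (halfGap p₁ p₂) * Real.cosh x

section

variable {p p₁ p₂ : ℝ}

theorem Ioo_subset_Icc (h : p ∈ Ioo (0 : ℝ) 1) : p ∈ Icc (0 : ℝ) 1 := Ioo_subset_Icc_self h

theorem odds_pos (h : p ∈ Ioo (0 : ℝ) 1) : 0 < (1 - p) / p := div_pos (sub_pos.2 h.2) h.1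

theorem tStar_eq_add (h₁ : p₁ ∈ Ioo (0 : ℝ) 1) (h₂ : p₂ ∈ Ioo (0 : ℝ) 1) :
    tStar p₁ p₂ = Real.log ((1 - p₁) / p₁) + Real.log ((1 - p₂) / p₂) :=
  Real.log_mul (odds_pos h₁).ne' (odds_pos h₂).ne'

theorem exp_tStar (h₁ : p₁ ∈ Ioo (0 : ℝ) 1) (h₂ : p₂ ∈ Ioo (0 : ℝ) 1) :
    Real.exp (tStar p₁ p₂) = (1 - p₁) / p₁ * ((1 - p₂) / p₂) :=
  Real.exp_log (mul_pos (odds_pos h₁) (odds_pos h₂))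

theorem tStar_pos_iff (h₁ : p₁ ∈ Ioo (0 : ℝ) 1) (h₂ : p₂ ∈ Ioo (0 : ℝ) 1) :
    0 < tStar p₁ p₂ ↔ p₁ + p₂ < 1 := by
  have hp := mul_pos h₁.1 h₂.1
  rw [← Real.one_lt_exp_iff, exp_tStar h₁ h₂, div_mul_div_comm, one_lt_div hp]
  constructor <;> intro h <;> linarith

theorem tStar_eq_zero (h₁ : p₁ ∈ Ioo (0 : ℝ) 1) (h₂ : p₂ ∈ Ioo (0 : ℝ) 1) (h : p₁ + p₂ = 1) :
    tStar p₁ p₂ = 0 := by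
  have := h₁.1.ne'
  have := h₂.1.ne'
  obtain rfl : p₂ = 1 - p₁ := by linarith
  rw [← Real.exp_eq_one_iff, exp_tStar h₁ h₂]
  field_simp
  ring

theorem tStar_nonneg (h₁ : p₁ ∈ Ioo (0 : ℝ) 1) (h₂ : p₂ ∈ Ioo (0 : ℝ) 1) (h : p₁ + p₂ ≤ 1) :
    0 ≤ tStar p₁ p₂ := by
  rcases h.lt_or_eq with h | h
  · exact ((tStar_pos_iff h₁ h₂).2 h).le
  · exact (tStar_eq_zero h₁ h₂ h).ge

/-- Divide numerator and denominator by p(1-p)eᵗ: the square becomes 2 plus the two reciprocal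
exponentials of t minus the log-odds. -/
theorem bernCgf₂_eq (h : p ∈ Ioo (0 : ℝ) 1) (t : ℝ) :
    bernCgf₂ p t = 1 / (2 + 2 * Real.cosh (t - Real.log ((1 - p) / p))) := by
  have h1 := h.1
  have h2 : 0 < 1 - p := sub_pos.2 h.2
  have he := Real.exp_pos t
  rw [bernCgf₂, Real.cosh_eq, neg_sub, Real.exp_sub, Real.exp_sub, Real.exp_log (odds_pos h)]
  have hw := bern_weight_pos (Ioo_subset_Icc h) t
  rw [div_eq_div_iff (by positivity) (by positivity)]
  field_simp
  ring

/-- With X = cosh x and K = cosh d, the product (1 + cosh(x-d))(1 + cosh(x+d)) collapses to (X +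
K)². -/
theorem one_div_add_one_div_cosh (x d : ℝ) :
    1 / (2 + 2 * Real.cosh (x - d)) + 1 / (2 + 2 * Real.cosh (x + d))
      = (1 + Real.cosh x * Real.cosh d) / (Real.cosh x + Real.cosh d) ^ 2 := by
  have hx := Real.cosh_pos x
  have hd := Real.cosh_pos d
  have h1 := Real.cosh_pos (x - d)
  have h2 := Real.cosh_pos (x + d)
  rw [div_add_div _ _ (by positivity) (by positivity), div_eq_div_iff (by positivity) (by positivity),
    Real.cosh_sub, Real.cosh_add]
  have ex := Real.sinh_sq x
  have ed := Real.sinh_sq d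
  generalize Real.sinh x = a at *
  generalize Real.sinh d = b at *
  generalize Real.cosh x = X at *
  generalize Real.cosh d = K at *
  have e : a ^ 2 * b ^ 2 = (X ^ 2 - 1) * (K ^ 2 - 1) := by rw [ex, ed]
  linear_combination (-4 * (1 + X * K) * (-1)) * e

theorem cgf₂_eq (h₁ : p₁ ∈ Ioo (0 : ℝ) 1) (h₂ : p₂ ∈ Ioo (0 : ℝ) 1) (t : ℝ) :
    cgf₂ p₁ p₂ t = (1 + Real.cosh (t - tStar p₁ p₂ / 2) * Real.cosh (halfGap p₁ p₂)) /
      (Real.cosh (t - tStar p₁ p₂ / 2) + Real.cosh (halfGap p₁ p₂)) ^ 2 := by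
  rw [cgf₂, bernCgf₂_eq h₁, bernCgf₂_eq h₂, ← one_div_add_one_div_cosh, tStar_eq_add h₁ h₂, halfGap]
  congr 5 <;> ring

/-- Differentiate the closed form of `cgf₂` and use uniqueness of the derivative, which avoids
adding the two rational third derivatives. -/
theorem cgf₃_eq (h₁ : p₁ ∈ Ioo (0 : ℝ) 1) (h₂ : p₂ ∈ Ioo (0 : ℝ) 1) (t : ℝ) :
    cgf₃ p₁ p₂ t = Real.sinh (t - tStar p₁ p₂ / 2) * shapeFactor p₁ p₂ (t - tStar p₁ p₂ / 2) /
      (Real.cosh (t - tStar p₁ p₂ / 2) + Real.cosh (halfGap p₁ p₂)) ^ 3 := by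
  refine (hasDerivAt_cgf₂ (Ioo_subset_Icc h₁) (Ioo_subset_Icc h₂) t).unique ?_
  have hx : HasDerivAt (fun t => Real.cosh (t - tStar p₁ p₂ / 2))
      (Real.sinh (t - tStar p₁ p₂ / 2)) t := by
    simpa using ((hasDerivAt_id' t).sub_const (tStar p₁ p₂ / 2)).cosh
  have hpos : Real.cosh (t - tStar p₁ p₂ / 2) + Real.cosh (halfGap p₁ p₂) ≠ 0 :=
    (add_pos (Real.cosh_pos _) (Real.cosh_pos _)).ne'
  have := ((hx.mul_const (Real.cosh (halfGap p₁ p₂))).const_add 1).fun_div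
    ((hx.add_const (Real.cosh (halfGap p₁ p₂))).fun_pow 2) (pow_ne_zero 2 hpos)
  rw [funext (cgf₂_eq h₁ h₂)]
  refine this.congr_deriv ?_
  rw [shapeFactor]
  field_simp
  push_cast
  ring

theorem cgf₃_denom_pos (t : ℝ) :
    0 < (Real.cosh (t - tStar p₁ p₂ / 2) + Real.cosh (halfGap p₁ p₂)) ^ 3 :=
  pow_pos (add_pos (Real.cosh_pos _) (Real.cosh_pos _)) 3

theorem shapeFactor_lt {x y : ℝ} (h : |x| < |y|) : shapeFactor p₁ p₂ y < shapeFactor p₁ p₂ x :=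
  sub_lt_sub_left (mul_lt_mul_of_pos_left (Real.cosh_lt_cosh.2 h) (Real.cosh_pos _)) _

theorem continuous_shapeFactor : Continuous (shapeFactor p₁ p₂) := by
  unfold shapeFactor
  fun_prop

/-- The quadratic form defining `A` is a negative multiple of the shape factor at `tStar / 2`. -/
theorem shapeFactor_half_tStar (h₁ : p₁ ∈ Ioo (0 : ℝ) 1) (h₂ : p₂ ∈ Ioo (0 : ℝ) 1) :
    4 * (p₁ * (1 - p₁) * (p₂ * (1 - p₂))) * shapeFactor p₁ p₂ (tStar p₁ p₂ / 2)
      = -(2 * p₁ * p₂ - p₁ * (2 * p₁ - 1) - p₂ * (2 * p₂ - 1)) := by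
  have h1 := h₁.1.ne'
  have h2 := h₂.1.ne'
  have h3 := (sub_pos.2 h₁.2).ne'
  have h4 := (sub_pos.2 h₂.2).ne'
  set a₁ := Real.log ((1 - p₁) / p₁) with ha₁
  set a₂ := Real.log ((1 - p₂) / p₂) with ha₂
  have c1 : Real.cosh a₁ = ((1 - p₁) / p₁ + p₁ / (1 - p₁)) / 2 := by
    rw [ha₁, Real.cosh_log (odds_pos h₁), inv_div]
  have c2 : Real.cosh a₂ = ((1 - p₂) / p₂ + p₂ / (1 - p₂)) / 2 := by
    rw [ha₂, Real.cosh_log (odds_pos h₂), inv_div]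
  have c3 : Real.cosh (a₁ - a₂) =
      ((1 - p₁) / p₁ * (p₂ / (1 - p₂)) + p₁ / (1 - p₁) * ((1 - p₂) / p₂)) / 2 := by
    rw [Real.cosh_eq, neg_sub, Real.exp_sub, Real.exp_sub, ha₁, ha₂, Real.exp_log (odds_pos h₁),
      Real.exp_log (odds_pos h₂)]
    field_simp
  -- Double-angle and product-to-sum formulas reduce both terms to cosh of the log-odds and of their
  -- difference, which are rational in p₁ and p₂.
  have k1 : Real.cosh (halfGap p₁ p₂) ^ 2 = (Real.cosh (a₁ - a₂) + 1) / 2 := by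
    have := Real.cosh_two_mul (halfGap p₁ p₂)
    rw [Real.sinh_sq, show 2 * halfGap p₁ p₂ = a₁ - a₂ by rw [halfGap]; ring] at this
    linarith
  have k2 : Real.cosh (halfGap p₁ p₂) * Real.cosh (tStar p₁ p₂ / 2)
      = (Real.cosh a₁ + Real.cosh a₂) / 2 := by
    have e1 : a₁ = tStar p₁ p₂ / 2 + halfGap p₁ p₂ := by
      rw [tStar_eq_add h₁ h₂, halfGap]; ring
    have e2 : a₂ = tStar p₁ p₂ / 2 - halfGap p₁ p₂ := by
      rw [tStar_eq_add h₁ h₂, halfGap]; ring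
    rw [e1, e2, Real.cosh_add, Real.cosh_sub]
    ring
  rw [shapeFactor, k1, k2, c1, c2, c3]
  field_simp
  ring

theorem mem_setA_iff_shapeFactor (h₁ : p₁ ∈ Ioo (0 : ℝ) 1) (h₂ : p₂ ∈ Ioo (0 : ℝ) 1) :
    (p₁, p₂) ∈ setA ↔ shapeFactor p₁ p₂ (tStar p₁ p₂ / 2) ≤ 0 := by
  have hpos : 0 < 4 * (p₁ * (1 - p₁) * (p₂ * (1 - p₂))) :=
    mul_pos four_pos (mul_pos (mul_pos h₁.1 (sub_pos.2 h₁.2)) (mul_pos h₂.1 (sub_pos.2 h₂.2)))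
  have e := shapeFactor_half_tStar h₁ h₂
  have : (p₁, p₂) ∈ setA ↔ 0 ≤ 2 * p₁ * p₂ - p₁ * (2 * p₁ - 1) - p₂ * (2 * p₂ - 1) :=
    ⟨fun h => h.2, fun h => ⟨⟨Ioo_subset_Icc h₁, Ioo_subset_Icc h₂⟩, h⟩⟩
  rw [this, ← neg_nonpos, ← e]
  exact ⟨fun h => nonpos_of_mul_nonpos_right h hpos, mul_nonpos_of_nonneg_of_nonpos hpos.le⟩

/-! ### Values at `tStar` -/

/-- Behind all the values at t*: exponential tilting by t* turns the Bernoulli parameter p₁ into 1 -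
p₂, and p₂ into 1 - p₁. -/
theorem bern_weight_tStar (h₁ : p₁ ∈ Ioo (0 : ℝ) 1) (h₂ : p₂ ∈ Ioo (0 : ℝ) 1) :
    p₁ * Real.exp (tStar p₁ p₂) + (1 - p₁) = (1 - p₁) / p₂ := by
  have h1 := h₁.1.ne'
  have h2 := h₂.1.ne'
  rw [exp_tStar h₁ h₂]
  field_simp
  ring

theorem tStar_comm : tStar p₁ p₂ = tStar p₂ p₁ := by
  rw [tStar, tStar, mul_comm]

theorem bernCgf₁_tStar (h₁ : p₁ ∈ Ioo (0 : ℝ) 1) (h₂ : p₂ ∈ Ioo (0 : ℝ) 1) :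
    bernCgf₁ p₁ (tStar p₁ p₂) = 1 - p₁ - p₂ := by
  have h1 := h₁.1.ne'
  have h2 := h₂.1.ne'
  have h3 := (sub_pos.2 h₁.2).ne'
  rw [bernCgf₁, bern_weight_tStar h₁ h₂, exp_tStar h₁ h₂]
  field_simp
  ring

theorem bernCgf₂_tStar (h₁ : p₁ ∈ Ioo (0 : ℝ) 1) (h₂ : p₂ ∈ Ioo (0 : ℝ) 1) :
    bernCgf₂ p₁ (tStar p₁ p₂) = p₂ * (1 - p₂) := by
  have h1 := h₁.1.ne'
  have h2 := h₂.1.ne'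
  have h3 := (sub_pos.2 h₁.2).ne'
  rw [bernCgf₂, bern_weight_tStar h₁ h₂, exp_tStar h₁ h₂]
  field_simp

theorem cgf_tStar (h₁ : p₁ ∈ Ioo (0 : ℝ) 1) (h₂ : p₂ ∈ Ioo (0 : ℝ) 1) :
    cgf p₁ p₂ (tStar p₁ p₂) = tStar p₁ p₂ * (1 - p₁ - p₂) := by
  have h1 := h₁.1
  have h2 := h₂.1
  have h3 := sub_pos.2 h₁.2
  have h4 := sub_pos.2 h₂.2
  have e : Real.log ((1 - p₁) / p₂) + Real.log ((1 - p₂) / p₁) = tStar p₁ p₂ := by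
    rw [← Real.log_mul (by positivity) (by positivity), tStar]
    congr 1
    field_simp
  rw [cgf, bernCgf, bernCgf, bern_weight_tStar h₁ h₂, tStar_comm, bern_weight_tStar h₂ h₁,
    tStar_comm]
  linear_combination e

theorem cgf₁_tStar (h₁ : p₁ ∈ Ioo (0 : ℝ) 1) (h₂ : p₂ ∈ Ioo (0 : ℝ) 1) :
    cgf₁ p₁ p₂ (tStar p₁ p₂) = 2 * (1 - p₁ - p₂) := by
  rw [cgf₁, bernCgf₁_tStar h₁ h₂, tStar_comm, bernCgf₁_tStar h₂ h₁]
  ring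

theorem cgf₂_tStar (h₁ : p₁ ∈ Ioo (0 : ℝ) 1) (h₂ : p₂ ∈ Ioo (0 : ℝ) 1) :
    cgf₂ p₁ p₂ (tStar p₁ p₂) = p₁ * (1 - p₁) + p₂ * (1 - p₂) := by
  rw [cgf₂, bernCgf₂_tStar h₁ h₂, tStar_comm, bernCgf₂_tStar h₂ h₁]
  ring

theorem excess_tStar (h₁ : p₁ ∈ Ioo (0 : ℝ) 1) (h₂ : p₂ ∈ Ioo (0 : ℝ) 1) :
    excess p₁ p₂ (tStar p₁ p₂) = 0 := by
  rw [excess, cgf₁_tStar h₁ h₂, cgf_tStar h₁ h₂]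
  ring

theorem excess₁_tStar (h₁ : p₁ ∈ Ioo (0 : ℝ) 1) (h₂ : p₂ ∈ Ioo (0 : ℝ) 1) :
    excess₁ p₁ p₂ (tStar p₁ p₂)
      = tStar p₁ p₂ * (p₁ * (1 - p₁) + p₂ * (1 - p₂)) - 2 * (1 - p₁ - p₂) := by
  rw [excess₁, cgf₂_tStar h₁ h₂, cgf₁_tStar h₁ h₂]

theorem hasDerivAt_gTwo_tStar (h₁ : p₁ ∈ Ioo (0 : ℝ) 1) (h₂ : p₂ ∈ Ioo (0 : ℝ) 1) :
    HasDerivAt (gTwo p₁ p₂) 0 (tStar p₁ p₂) := by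
  rcases eq_or_ne (tStar p₁ p₂) 0 with h | h
  -- When t* = 0 the derivative at 0 is `cgf₃` at 0 over 6, and this contains the factor sinh 0.
  · have := hasDerivAt_gTwo_zero (Ioo_subset_Icc h₁) (Ioo_subset_Icc h₂)
    rw [h]
    refine this.congr_deriv ?_
    rw [cgf₃_eq h₁ h₂, h]
    simp
  · have := hasDerivAt_gTwo (Ioo_subset_Icc h₁) (Ioo_subset_Icc h₂) h
    rwa [excess_tStar h₁ h₂, zero_div] at this

end

end

/-! ### The half `p₁ + p₂ ≤ 1` of the square -/

section

variable {p p₁ p₂ : ℝ}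

/-- A point outside [0, t*] is farther than t*/2 from the centre, so the shape factor there is
strictly below its value at t*/2. -/
theorem cgf₃_pos_of_neg (h₁ : p₁ ∈ Ioo (0 : ℝ) 1) (h₂ : p₂ ∈ Ioo (0 : ℝ) 1) (hs : p₁ + p₂ ≤ 1)
    (hN : shapeFactor p₁ p₂ (tStar p₁ p₂ / 2) ≤ 0) {t : ℝ} (ht : t < 0) : 0 < cgf₃ p₁ p₂ t := by
  have hc := tStar_nonneg h₁ h₂ hs
  have hneg : t - tStar p₁ p₂ / 2 < 0 := by linarith
  rw [cgf₃_eq h₁ h₂]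
  refine div_pos (mul_pos_of_neg_of_neg (Real.sinh_neg_iff.2 hneg) ?_) (cgf₃_denom_pos t)
  refine (shapeFactor_lt ?_).trans_le hN
  rw [abs_of_neg hneg, abs_of_nonneg (by linarith)]
  linarith

theorem cgf₃_neg_of_tStar_lt (h₁ : p₁ ∈ Ioo (0 : ℝ) 1) (h₂ : p₂ ∈ Ioo (0 : ℝ) 1)
    (hs : p₁ + p₂ ≤ 1) (hN : shapeFactor p₁ p₂ (tStar p₁ p₂ / 2) ≤ 0) {t : ℝ}
    (ht : tStar p₁ p₂ < t) : cgf₃ p₁ p₂ t < 0 := by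
  have hc := tStar_nonneg h₁ h₂ hs
  have hpos : 0 < t - tStar p₁ p₂ / 2 := by linarith
  rw [cgf₃_eq h₁ h₂]
  refine div_neg_of_neg_of_pos (mul_neg_of_pos_of_neg (Real.sinh_pos_iff.2 hpos) ?_)
    (cgf₃_denom_pos t)
  refine (shapeFactor_lt ?_).trans_le hN
  rw [abs_of_pos hpos, abs_of_nonneg (by linarith)]
  linarith

theorem exists_excess_pos_of_cgf₃_neg (h₁ : p₁ ∈ Icc (0 : ℝ) 1) (h₂ : p₂ ∈ Icc (0 : ℝ) 1)
    (h : ∀ᶠ t in 𝓝[<] 0, cgf₃ p₁ p₂ t < 0) : ∃ t < 0, 0 < excess p₁ p₂ t := by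
  obtain ⟨b, hb, hb'⟩ := mem_nhdsLT_iff_exists_Ioo_subset.1 h
  obtain ⟨t, ht⟩ := exists_between (Set.mem_Iio.1 hb)
  exact ⟨t, ht.2, excess_pos_of_cgf₃_neg_left h₁ h₂ (fun t ht => hb' ht) t ht⟩

theorem exists_excess_pos_of_cgf₃_zero_neg (h₁ : p₁ ∈ Icc (0 : ℝ) 1) (h₂ : p₂ ∈ Icc (0 : ℝ) 1)
    (h : cgf₃ p₁ p₂ 0 < 0) : ∃ t < 0, 0 < excess p₁ p₂ t :=
  exists_excess_pos_of_cgf₃_neg h₁ h₂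
    (((continuous_cgf₃ h₁ h₂).continuousAt.eventually_lt_const h).filter_mono nhdsWithin_le_nhds)

theorem excess_neg_left_iff (h₁ : p₁ ∈ Ioo (0 : ℝ) 1) (h₂ : p₂ ∈ Ioo (0 : ℝ) 1)
    (hs : p₁ + p₂ ≤ 1) : (∀ t < 0, excess p₁ p₂ t < 0) ↔ (p₁, p₂) ∈ setA := by
  rw [mem_setA_iff_shapeFactor h₁ h₂]
  have i₁ := Ioo_subset_Icc h₁
  have i₂ := Ioo_subset_Icc h₂
  constructor
  · intro h
    by_contra! hN
    have hc := tStar_nonneg h₁ h₂ hs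
    -- Evenness carries positivity of the shape factor at t*/2 to a neighbourhood of t = 0. Only t <
    -- 0 is used, because `cgf₃` vanishes at 0 when t* = 0.
    obtain ⟨t, ht, ht'⟩ := exists_excess_pos_of_cgf₃_neg i₁ i₂ (by
      have hev : ∀ᶠ t in 𝓝 (0 : ℝ), 0 < shapeFactor p₁ p₂ (t - tStar p₁ p₂ / 2) := by
        have : Continuous fun t => shapeFactor p₁ p₂ (t - tStar p₁ p₂ / 2) :=
          continuous_shapeFactor.comp (by fun_prop)
        refine this.continuousAt.eventually_const_lt ?_
        simpa [shapeFactor] using hN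
      filter_upwards [hev.filter_mono nhdsWithin_le_nhds, self_mem_nhdsWithin] with t h1 h2
      rw [cgf₃_eq h₁ h₂]
      have h2 : t < 0 := h2
      exact div_neg_of_neg_of_pos (mul_neg_of_neg_of_pos (Real.sinh_neg_iff.2 (by linarith)) h1)
        (cgf₃_denom_pos t))
    exact (h t ht).not_gt ht'
  · exact fun hN t ht => excess_neg_of_cgf₃_pos_left i₁ i₂ (b := t - 1)
      (fun s hs' => cgf₃_pos_of_neg h₁ h₂ hs hN hs'.2) t ⟨by linarith, ht⟩

/-- The case of an edge of the square. -/
theorem excess_neg_left_iff_of_zero (hp : p ∈ Ioc (0 : ℝ) 1) :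
    (∀ t < 0, excess 0 p t < 0) ↔ (0, p) ∈ setA := by
  have i₁ : (0 : ℝ) ∈ Icc (0 : ℝ) 1 := ⟨le_rfl, zero_le_one⟩
  have i₂ : p ∈ Icc (0 : ℝ) 1 := Ioc_subset_Icc_self hp
  have e : ∀ t, cgf₃ 0 p t = bernCgf₃ p t := fun t => by simp [cgf₃, bernCgf₃]
  have hA : (0, p) ∈ setA ↔ p ≤ 1 / 2 := by
    constructor
    · rintro ⟨-, h⟩
      by_contra! h'
      have : 0 < p * (2 * p - 1) := mul_pos hp.1 (by linarith)
      simp only at h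
      linarith
    · intro h
      refine ⟨⟨i₁, i₂⟩, ?_⟩
      have : 0 ≤ p * (1 - 2 * p) := mul_nonneg hp.1.le (by linarith)
      simp only
      linarith
  rw [hA]
  constructor
  · intro h
    by_contra! hlt
    -- At the corner (0, 1) `excess` vanishes identically, so strict negativity fails.
    rcases hp.2.eq_or_lt with rfl | h1
    · have := h (-1) (by norm_num)
      simp [excess, cgf, cgf₁, bernCgf, bernCgf₁] at this
    · obtain ⟨t, ht, ht'⟩ := exists_excess_pos_of_cgf₃_zero_neg i₁ i₂ (by
        rw [e, bernCgf₃]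
        have hq : 0 < 1 - p := sub_pos.2 h1
        have : p * (1 - p) * (1 - p - p) < 0 :=
          mul_neg_of_pos_of_neg (mul_pos hp.1 hq) (by linarith)
        simpa using this)
      exact (h t ht).not_gt ht'
  · refine fun hle t ht => excess_neg_of_cgf₃_pos_left i₁ i₂ (b := t - 1)
      (fun s hs => ?_) t ⟨by linarith, ht⟩
    rw [e, bernCgf₃]
    have hq : 0 < 1 - p := by linarith
    have hexp : p * Real.exp s < p * 1 :=
      mul_lt_mul_of_pos_left (Real.exp_lt_one_iff.2 hs.2) hp.1
    exact div_pos (mul_pos (mul_pos (mul_pos hp.1 hq) (Real.exp_pos s)) (by linarith))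
      (pow_pos (bern_weight_pos i₂ s) 3)

theorem gTwo_comm : gTwo p₁ p₂ = gTwo p₂ p₁ := funext fun t => by rw [gTwo, gTwo, add_comm]

theorem mem_setA_comm : (p₁, p₂) ∈ setA ↔ (p₂, p₁) ∈ setA := by
  simp only [setA, mem_ofPred_eq, mem_prod]
  rw [and_comm (a := p₁ ∈ Icc (0 : ℝ) 1)]
  refine and_congr_right' ?_
  rw [show 2 * p₁ * p₂ - p₁ * (2 * p₁ - 1) - p₂ * (2 * p₂ - 1)
    = 2 * p₂ * p₁ - p₂ * (2 * p₂ - 1) - p₁ * (2 * p₁ - 1) by ring]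

theorem deriv_gTwo_pos_left_iff_mem_setA (h₁ : p₁ ∈ Icc (0 : ℝ) 1) (h₂ : p₂ ∈ Icc (0 : ℝ) 1)
    (h0 : (p₁, p₂) ≠ (0, 0)) (hs : p₁ + p₂ ≤ 1) :
    (∀ t < 0, 0 < deriv (gTwo p₁ p₂) t) ↔ (p₁, p₂) ∈ setA := by
  wlog hle : p₁ ≤ p₂ generalizing p₁ p₂
  · rw [gTwo_comm, mem_setA_comm]
    exact this h₂ h₁ (fun h => h0 (by simp_all)) (by linarith) (le_of_not_ge hle)
  have e : (∀ t < 0, 0 < deriv (gTwo p₁ p₂) t) ↔ ∀ t < 0, excess p₁ p₂ t < 0 :=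
    forall₂_congr fun t ht => deriv_gTwo_pos_iff_of_neg h₁ h₂ ht
  rw [e]
  -- If the smaller parameter is positive, p₁ + p₂ ≤ 1 puts the point in the open square; otherwise
  -- it lies on an edge.
  rcases h₁.1.eq_or_lt with rfl | hpos
  · have : p₂ ≠ 0 := fun h => h0 (by rw [h])
    exact excess_neg_left_iff_of_zero ⟨h₂.1.lt_of_ne' this, h₂.2⟩
  · exact excess_neg_left_iff ⟨hpos, by linarith⟩ ⟨by linarith, by linarith⟩ hs

/-! ### The set B and the ray beyond `tStar` -/

theorem mem_setB_iff_of_lt (h₁ : p₁ ∈ Ioo (0 : ℝ) 1) (h₂ : p₂ ∈ Ioo (0 : ℝ) 1)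
    (hs : p₁ + p₂ < 1) : (p₁, p₂) ∈ setB ↔ excess₁ p₁ p₂ (tStar p₁ p₂) ≤ 0 := by
  have ht := (tStar_pos_iff h₁ h₂).2 hs
  have hv : 0 < p₁ * (1 - p₁) + p₂ * (1 - p₂) :=
    add_pos (mul_pos h₁.1 (sub_pos.2 h₁.2)) (mul_pos h₂.1 (sub_pos.2 h₂.2))
  have hd : 0 < 1 - p₁ - p₂ := by linarith
  have n0 : (p₁, p₂) ≠ (0, 0) := fun h => h₁.1.ne' (Prod.ext_iff.1 h).1
  have n1 : (p₁, p₂) ≠ (1, 1) := fun h => h₁.2.ne (Prod.ext_iff.1 h).1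
  rw [excess₁_tStar h₁ h₂, sub_nonpos, ← le_div_iff₀ hv]
  simp only [setB, mem_union, mem_ofPred_eq, mem_insert_iff, mem_singleton_iff, n0, n1, or_self,
    or_false, hs.ne, false_imp_iff, and_true, abs_of_pos ht, abs_of_pos hd, mem_prod, h₁, h₂,
    true_and]

theorem mem_setB_iff_of_eq (h₁ : p₁ ∈ Ioo (0 : ℝ) 1) (h₂ : p₂ ∈ Ioo (0 : ℝ) 1)
    (hs : p₁ + p₂ = 1) : (p₁, p₂) ∈ setB ↔ (p₁, p₂) ∈ setA := by
  have ht := tStar_eq_zero h₁ h₂ hs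
  have n0 : (p₁, p₂) ≠ (0, 0) := fun h => h₁.1.ne' (Prod.ext_iff.1 h).1
  have n1 : (p₁, p₂) ≠ (1, 1) := fun h => h₁.2.ne (Prod.ext_iff.1 h).1
  have hd : 1 - p₁ - p₂ = 0 := by linarith
  simp only [setB, setA, mem_union, mem_ofPred_eq, mem_insert_iff, mem_singleton_iff, n0, n1,
    or_self, or_false, hs, ht, hd, abs_zero, mul_zero, zero_div, le_refl, true_and, mem_prod, h₁,
    h₂, Ioo_subset_Icc h₁, Ioo_subset_Icc h₂, forall_const]
  have h3 : √3 ^ 2 = 3 := Real.sq_sqrt (by norm_num)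
  -- On the antidiagonal the form is 6p₁(1 - p₁) - 1, with roots (3 ± √3)/6.
  have e : 2 * p₁ * p₂ - p₁ * (2 * p₁ - 1) - p₂ * (2 * p₂ - 1)
      = 6 * ((p₁ - (3 - √3) / 6) * ((3 + √3) / 6 - p₁)) := by
    obtain rfl : p₂ = 1 - p₁ := by linarith
    linear_combination (-1 / 6) * h3
  have hr : 0 < √3 := by positivity
  rw [e]
  constructor
  · rintro ⟨ha, hb⟩
    exact mul_nonneg (by norm_num) (mul_nonneg (sub_nonneg.2 ha) (sub_nonneg.2 hb))
  · intro h
    constructor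
    · by_contra! h'
      have : (p₁ - (3 - √3) / 6) * ((3 + √3) / 6 - p₁) < 0 :=
        mul_neg_of_neg_of_pos (by linarith) (by linarith)
      linarith
    · by_contra! h'
      have : (p₁ - (3 - √3) / 6) * ((3 + √3) / 6 - p₁) < 0 :=
        mul_neg_of_pos_of_neg (by linarith) (by linarith)
      linarith

/-- Monotonicity of `X ↦ (1 + X K) / (X + K) ^ 2` to the left of its maximum. -/
theorem div_sq_lt_div_sq {X Y K : ℝ} (hX : 0 < X) (hK : 0 < K) (hXY : X < Y)
    (hY : 0 ≤ K ^ 2 - 2 - K * Y) :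
    (1 + X * K) / (X + K) ^ 2 < (1 + Y * K) / (Y + K) ^ 2 := by
  have hYpos : 0 < Y := hX.trans hXY
  rw [div_lt_div_iff₀ (by positivity) (by positivity)]
  -- After cross-multiplying, the difference of the two sides is Y - X times this expression.
  have hb : 0 < K ^ 3 - 2 * K - (X + Y) - X * Y * K := by
    have e : K ^ 3 - 2 * K - (X + Y) - X * Y * K
        = (K + Y) * (K ^ 2 - 2 - K * Y) + (Y - X) + K * Y * (Y - X) := by ring
    have := mul_nonneg (add_pos hK hYpos).le hY
    have := mul_pos (mul_pos hK hYpos) (sub_pos.2 hXY)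
    linarith
  have := mul_pos (sub_pos.2 hXY) hb
  linarith

/-- If the factor were nonnegative at t*/2, then Φ'' on (0, t*) would stay below Φ''(t*). The mean
value theorem would give Φ'(t*) < t*Φ''(t*), that is, E'(t*) > 0. -/
theorem shapeFactor_neg_of_excess₁_nonpos (h₁ : p₁ ∈ Ioo (0 : ℝ) 1) (h₂ : p₂ ∈ Ioo (0 : ℝ) 1)
    (hs : p₁ + p₂ < 1) (h : excess₁ p₁ p₂ (tStar p₁ p₂) ≤ 0) :
    shapeFactor p₁ p₂ (tStar p₁ p₂ / 2) < 0 := by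
  by_contra! hN
  have ht := (tStar_pos_iff h₁ h₂).2 hs
  have i₁ := Ioo_subset_Icc h₁
  have i₂ := Ioo_subset_Icc h₂
  obtain ⟨ξ, hξ, e⟩ := exists_hasDerivAt_eq_slope (cgf₁ p₁ p₂) (cgf₂ p₁ p₂) ht
    (fun t _ => (hasDerivAt_cgf₁ i₁ i₂ t).continuousAt.continuousWithinAt)
    (fun t _ => hasDerivAt_cgf₁ i₁ i₂ t)
  rw [cgf₁_zero, sub_zero, sub_zero, eq_div_iff ht.ne'] at e
  have hlt : cgf₂ p₁ p₂ ξ < cgf₂ p₁ p₂ (tStar p₁ p₂) := by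
    rw [cgf₂_eq h₁ h₂, cgf₂_eq h₁ h₂, sub_half]
    refine div_sq_lt_div_sq (Real.cosh_pos _) (Real.cosh_pos _) (Real.cosh_lt_cosh.2 ?_) hN
    rw [abs_of_pos (half_pos ht), abs_lt]
    constructor <;> linarith [hξ.1, hξ.2]
  have := mul_lt_mul_of_pos_right hlt ht
  rw [excess₁] at h
  linarith

theorem excess_neg_right_of_excess₁_nonpos (h₁ : p₁ ∈ Ioo (0 : ℝ) 1) (h₂ : p₂ ∈ Ioo (0 : ℝ) 1)
    (hs : p₁ + p₂ ≤ 1) (hN : shapeFactor p₁ p₂ (tStar p₁ p₂ / 2) ≤ 0)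
    (h : excess₁ p₁ p₂ (tStar p₁ p₂) ≤ 0) : ∀ t > tStar p₁ p₂, excess p₁ p₂ t < 0 := by
  have i₁ := Ioo_subset_Icc h₁
  have i₂ := Ioo_subset_Icc h₂
  refine fun t ht => neg_right_of_second_deriv_neg (a := tStar p₁ p₂) (b := t + 1)
    (hasDerivAt_excess_cgf i₁ i₂) (hasDerivAt_excess₁ i₁ i₂) (excess_tStar h₁ h₂).le h
    (fun s hs' => ?_) t ⟨ht, by linarith⟩
  exact mul_neg_of_pos_of_neg ((tStar_nonneg h₁ h₂ hs).trans_lt hs'.1)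
    (cgf₃_neg_of_tStar_lt h₁ h₂ hs hN hs'.1)

theorem excess_neg_right_iff (h₁ : p₁ ∈ Ioo (0 : ℝ) 1) (h₂ : p₂ ∈ Ioo (0 : ℝ) 1)
    (hs : p₁ + p₂ ≤ 1) :
    (∀ t > tStar p₁ p₂, excess p₁ p₂ t < 0) ↔ (p₁, p₂) ∈ setB := by
  have i₁ := Ioo_subset_Icc h₁
  have i₂ := Ioo_subset_Icc h₂
  rcases hs.lt_or_eq with hs' | hs'
  · rw [mem_setB_iff_of_lt h₁ h₂ hs']
    exact ⟨deriv_nonpos_of_neg_right (hasDerivAt_excess_cgf i₁ i₂ _) (excess_tStar h₁ h₂),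
      fun h => excess_neg_right_of_excess₁_nonpos h₁ h₂ hs
        (shapeFactor_neg_of_excess₁_nonpos h₁ h₂ hs' h).le h⟩
  -- Here t* = 0 and E'(0) = 0 holds automatically, so the first-order test is void and the shape
  -- factor decides.
  · rw [mem_setB_iff_of_eq h₁ h₂ hs', mem_setA_iff_shapeFactor h₁ h₂]
    have ht := tStar_eq_zero h₁ h₂ hs'
    constructor
    · intro h
      by_contra! hN
      rw [ht, zero_div] at hN
      rw [ht] at h
      obtain ⟨b, hb, hb'⟩ := mem_nhdsGT_iff_exists_Ioo_subset.1
        ((continuous_shapeFactor.continuousAt.eventually_const_lt hN).filter_mono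
          nhdsWithin_le_nhds : ∀ᶠ t in 𝓝[>] 0, 0 < shapeFactor p₁ p₂ t)
      obtain ⟨t, ht'⟩ := exists_between (Set.mem_Ioi.1 hb)
      refine (h t ht'.1).not_gt (excess_pos_of_cgf₃_pos_right i₁ i₂ (fun s hs => ?_) t ht')
      rw [cgf₃_eq h₁ h₂]
      refine div_pos (mul_pos ?_ ?_) (cgf₃_denom_pos s)
      · rw [ht, zero_div, sub_zero]
        exact Real.sinh_pos_iff.2 hs.1
      · rw [ht, zero_div, sub_zero]
        exact hb' hs
    · intro hN
      refine excess_neg_right_of_excess₁_nonpos h₁ h₂ hs hN ?_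
      rw [ht, excess₁_zero]

theorem deriv_gTwo_neg_right_iff_mem_setB (h₁ : p₁ ∈ Ioo (0 : ℝ) 1) (h₂ : p₂ ∈ Ioo (0 : ℝ) 1)
    (hs : p₁ + p₂ ≤ 1) :
    (∀ t > tStar p₁ p₂, deriv (gTwo p₁ p₂) t < 0) ↔ (p₁, p₂) ∈ setB := by
  rw [← excess_neg_right_iff h₁ h₂ hs]
  exact forall₂_congr fun t ht => deriv_gTwo_neg_iff_of_pos (Ioo_subset_Icc h₁)
    (Ioo_subset_Icc h₂) ((tStar_nonneg h₁ h₂ hs).trans_lt ht)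

theorem mem_setA_of_mem_setB_of_le (h₁ : p₁ ∈ Ioo (0 : ℝ) 1) (h₂ : p₂ ∈ Ioo (0 : ℝ) 1)
    (hs : p₁ + p₂ ≤ 1) (h : (p₁, p₂) ∈ setB) : (p₁, p₂) ∈ setA := by
  rcases hs.lt_or_eq with hs' | hs'
  · rw [mem_setB_iff_of_lt h₁ h₂ hs'] at h
    exact (mem_setA_iff_shapeFactor h₁ h₂).2 (shapeFactor_neg_of_excess₁_nonpos h₁ h₂ hs' h).le
  · exact (mem_setB_iff_of_eq h₁ h₂ hs').1 h

/-! ### Unimodality and the interval between 0 and `tStar` -/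

theorem mem_setB_of_deriv_pos (h₁ : p₁ ∈ Ioo (0 : ℝ) 1) (h₂ : p₂ ∈ Ioo (0 : ℝ) 1)
    (hs : p₁ + p₂ < 1) (h : ∀ t ∈ Ioo 0 (tStar p₁ p₂), 0 < deriv (gTwo p₁ p₂) t) :
    (p₁, p₂) ∈ setB := by
  have i₁ := Ioo_subset_Icc h₁
  have i₂ := Ioo_subset_Icc h₂
  rw [mem_setB_iff_of_lt h₁ h₂ hs]
  -- E descends to its zero at t* through positive values.
  exact deriv_nonpos_of_pos_left (hasDerivAt_excess_cgf i₁ i₂ _) (excess_tStar h₁ h₂)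
    ((tStar_pos_iff h₁ h₂).2 hs)
    fun t ht => (deriv_gTwo_pos_iff_of_pos i₁ i₂ ht.1).1 (h t ht)

/-- The mode of a strictly unimodal function is its only critical point. -/
theorem StrictlyUnimodal.signs_of_hasDerivAt_zero {f : ℝ → ℝ} (h : StrictlyUnimodal f) {x : ℝ}
    (hx : HasDerivAt f 0 x) : (∀ t < x, 0 < deriv f t) ∧ ∀ t > x, deriv f t < 0 := by
  obtain ⟨-, y, hl, hr⟩ := h
  obtain rfl : x = y := by
    rcases lt_trichotomy x y with hxy | rfl | hxy
    · exact absurd hx.deriv (hl x hxy).ne'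
    · rfl
    · exact absurd hx.deriv (hr x hxy).ne
  exact ⟨hl, hr⟩

theorem strictlyUnimodal_of_lt (h₁ : p₁ ∈ Ioo (0 : ℝ) 1) (h₂ : p₂ ∈ Ioo (0 : ℝ) 1)
    (hs : p₁ + p₂ < 1) (h : ∀ t ∈ Ioo 0 (tStar p₁ p₂), 0 < deriv (gTwo p₁ p₂) t) :
    StrictlyUnimodal (gTwo p₁ p₂) := by
  have i₁ := Ioo_subset_Icc h₁
  have i₂ := Ioo_subset_Icc h₂
  have hB := mem_setB_of_deriv_pos h₁ h₂ hs h
  have hA := mem_setA_of_mem_setB_of_le h₁ h₂ hs.le hB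
  refine ⟨differentiable_gTwo i₁ i₂, tStar p₁ p₂, fun t ht => ?_,
    (deriv_gTwo_neg_right_iff_mem_setB h₁ h₂ hs.le).2 hB⟩
  rcases lt_trichotomy t 0 with ht0 | rfl | ht0
  · have n0 : (p₁, p₂) ≠ (0, 0) := fun h => h₁.1.ne' (Prod.ext_iff.1 h).1
    exact (deriv_gTwo_pos_left_iff_mem_setA i₁ i₂ n0 hs.le).2 hA t ht0
  -- At t = 0 the sign of E says nothing; the strict inequality for the shape factor is what makes
  -- the derivative positive.
  · rw [(hasDerivAt_gTwo_zero i₁ i₂).deriv, cgf₃_eq h₁ h₂]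
    have hN := shapeFactor_neg_of_excess₁_nonpos h₁ h₂ hs ((mem_setB_iff_of_lt h₁ h₂ hs).1 hB)
    refine div_pos (div_pos (mul_pos_of_neg_of_neg ?_ ?_) (cgf₃_denom_pos 0)) (by norm_num)
    · exact Real.sinh_neg_iff.2 (by linarith)
    · simpa [shapeFactor] using hN
  · exact h t ⟨ht0, ht⟩

theorem deriv_gTwo_pos_iff_strictlyUnimodal (h₁ : p₁ ∈ Ioo (0 : ℝ) 1) (h₂ : p₂ ∈ Ioo (0 : ℝ) 1)
    (hs : p₁ + p₂ < 1) :
    (∀ t ∈ Ioo 0 (tStar p₁ p₂), 0 < deriv (gTwo p₁ p₂) t) ↔ StrictlyUnimodal (gTwo p₁ p₂) :=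
  ⟨strictlyUnimodal_of_lt h₁ h₂ hs,
    fun h t ht => (h.signs_of_hasDerivAt_zero (hasDerivAt_gTwo_tStar h₁ h₂)).1 t ht.2⟩

theorem mem_setB_of_strictlyUnimodal_of_le (h₁ : p₁ ∈ Ioo (0 : ℝ) 1) (h₂ : p₂ ∈ Ioo (0 : ℝ) 1)
    (hs : p₁ + p₂ ≤ 1) (h : StrictlyUnimodal (gTwo p₁ p₂)) : (p₁, p₂) ∈ setB :=
  (deriv_gTwo_neg_right_iff_mem_setB h₁ h₂ hs).1
    (h.signs_of_hasDerivAt_zero (hasDerivAt_gTwo_tStar h₁ h₂)).2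

/-! ### Reflection `(p₁, p₂, t) ↦ (1 - p₁, 1 - p₂, -t)` -/

theorem one_sub_mem_Icc (h : p ∈ Icc (0 : ℝ) 1) : 1 - p ∈ Icc (0 : ℝ) 1 :=
  ⟨by linarith [h.2], by linarith [h.1]⟩

theorem one_sub_mem_Ioo (h : p ∈ Ioo (0 : ℝ) 1) : 1 - p ∈ Ioo (0 : ℝ) 1 :=
  ⟨by linarith [h.2], by linarith [h.1]⟩

theorem gOne_one_sub (p t : ℝ) : gOne (1 - p) t = gOne p (-t) := by
  simp only [gOne, neg_eq_zero, sub_sub_cancel, even_two.neg_pow]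
  split_ifs
  · ring
  · rw [add_comm]
    congr 5 <;> ring_nf

theorem gTwo_one_sub (p₁ p₂ : ℝ) : gTwo (1 - p₁) (1 - p₂) = fun t => gTwo p₁ p₂ (-t) :=
  funext fun t => by rw [gTwo, gTwo, gOne_one_sub, gOne_one_sub]

theorem deriv_gTwo_one_sub (p₁ p₂ t : ℝ) :
    deriv (gTwo (1 - p₁) (1 - p₂)) t = -deriv (gTwo p₁ p₂) (-t) := by
  rw [gTwo_one_sub, deriv_comp_neg]

theorem tStar_one_sub (p₁ p₂ : ℝ) : tStar (1 - p₁) (1 - p₂) = -tStar p₁ p₂ := by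
  rw [tStar, tStar, ← Real.log_inv, sub_sub_cancel, sub_sub_cancel, mul_inv, inv_div, inv_div]

theorem mem_setA_one_sub : (1 - p₁, 1 - p₂) ∈ setA ↔ (p₁, p₂) ∈ setA := by
  have key : ∀ {q₁ q₂ : ℝ}, (q₁, q₂) ∈ setA → (1 - q₁, 1 - q₂) ∈ setA := by
    rintro q₁ q₂ ⟨⟨h₁, h₂⟩, h⟩
    refine ⟨⟨one_sub_mem_Icc h₁, one_sub_mem_Icc h₂⟩, ?_⟩
    simp only at h ⊢
    linarith
  -- The reflection is an involution, so one implication yields both.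
  exact ⟨fun h => by simpa using key h, key⟩

theorem mem_setB_one_sub : (1 - p₁, 1 - p₂) ∈ setB ↔ (p₁, p₂) ∈ setB := by
  have key : ∀ {q₁ q₂ : ℝ}, (q₁, q₂) ∈ setB → (1 - q₁, 1 - q₂) ∈ setB := by
    rintro q₁ q₂ (⟨⟨h₁, h₂⟩, h, h'⟩ | h | h)
    · refine Or.inl ⟨⟨one_sub_mem_Ioo h₁, one_sub_mem_Ioo h₂⟩, ?_, fun hs => ?_⟩
      · simp only at h ⊢
        rw [tStar_one_sub, abs_neg, show 1 - (1 - q₁) - (1 - q₂) = -(1 - q₁ - q₂) by ring, abs_neg,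
          sub_sub_cancel, sub_sub_cancel, mul_comm (1 - q₁), mul_comm (1 - q₂)]
        exact h
      · simp only at hs h' ⊢
        obtain ⟨ha, hb⟩ := h' (by linarith)
        exact ⟨by linarith, by linarith⟩
    · obtain ⟨rfl, rfl⟩ := Prod.mk.inj h
      exact Or.inr (Or.inr (by simp))
    · obtain ⟨rfl, rfl⟩ := Prod.mk.inj h
      exact Or.inr (Or.inl (by simp))
  exact ⟨fun h => by simpa using key h, key⟩

theorem StrictlyUnimodal.comp_neg {f : ℝ → ℝ} (h : StrictlyUnimodal f) :
    StrictlyUnimodal fun t => f (-t) := by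
  obtain ⟨hd, x, hl, hr⟩ := h
  refine ⟨hd.comp differentiable_neg, -x, fun t ht => ?_, fun t ht => ?_⟩
  · rw [deriv_comp_neg]
    linarith [hr (-t) (by linarith)]
  · rw [deriv_comp_neg]
    linarith [hl (-t) (by linarith)]

theorem strictlyUnimodal_gTwo_one_sub :
    StrictlyUnimodal (gTwo (1 - p₁) (1 - p₂)) ↔ StrictlyUnimodal (gTwo p₁ p₂) := by
  rw [gTwo_one_sub]
  exact ⟨fun h => by simpa using h.comp_neg, StrictlyUnimodal.comp_neg⟩

theorem deriv_gTwo_neg_right_iff_mem_setA (h₁ : p₁ ∈ Icc (0 : ℝ) 1) (h₂ : p₂ ∈ Icc (0 : ℝ) 1)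
    (h0 : (p₁, p₂) ≠ (1, 1)) (hs : 1 ≤ p₁ + p₂) :
    (∀ t > 0, deriv (gTwo p₁ p₂) t < 0) ↔ (p₁, p₂) ∈ setA := by
  rw [← mem_setA_one_sub, ← deriv_gTwo_pos_left_iff_mem_setA (one_sub_mem_Icc h₁)
    (one_sub_mem_Icc h₂) ?_ (by linarith)]
  · simp only [deriv_gTwo_one_sub, neg_pos]
    exact ⟨fun h t ht => h _ (by linarith), fun h t ht => by simpa using h (-t) (by linarith)⟩
  · intro h
    obtain ⟨ha, hb⟩ := Prod.mk.inj h
    exact h0 (Prod.ext (by simp only; linarith) (by simp only; linarith))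

theorem deriv_gTwo_pos_left_iff_mem_setB (h₁ : p₁ ∈ Ioo (0 : ℝ) 1) (h₂ : p₂ ∈ Ioo (0 : ℝ) 1)
    (hs : 1 ≤ p₁ + p₂) :
    (∀ t < tStar p₁ p₂, 0 < deriv (gTwo p₁ p₂) t) ↔ (p₁, p₂) ∈ setB := by
  rw [← mem_setB_one_sub, ← deriv_gTwo_neg_right_iff_mem_setB (one_sub_mem_Ioo h₁)
    (one_sub_mem_Ioo h₂) (by linarith)]
  simp only [deriv_gTwo_one_sub, neg_neg_iff_pos, tStar_one_sub]
  exact ⟨fun h t ht => h _ (by linarith), fun h t ht => by simpa using h (-t) (by linarith)⟩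

theorem deriv_gTwo_neg_iff_strictlyUnimodal (h₁ : p₁ ∈ Ioo (0 : ℝ) 1) (h₂ : p₂ ∈ Ioo (0 : ℝ) 1)
    (hs : 1 < p₁ + p₂) :
    (∀ t ∈ Ioo (tStar p₁ p₂) 0, deriv (gTwo p₁ p₂) t < 0) ↔ StrictlyUnimodal (gTwo p₁ p₂) := by
  rw [← strictlyUnimodal_gTwo_one_sub, ← deriv_gTwo_pos_iff_strictlyUnimodal (one_sub_mem_Ioo h₁)
    (one_sub_mem_Ioo h₂) (by linarith)]
  simp only [deriv_gTwo_one_sub, neg_pos, tStar_one_sub]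
  exact ⟨fun h t ht => h _ ⟨by linarith [ht.2], by linarith [ht.1]⟩,
    fun h t ht => by simpa using h (-t) ⟨by linarith [ht.2], by linarith [ht.1]⟩⟩

/-! ### The inclusions and the set C on the whole square -/

theorem mem_setB_of_strictlyUnimodal (h₁ : p₁ ∈ Ioo (0 : ℝ) 1) (h₂ : p₂ ∈ Ioo (0 : ℝ) 1)
    (h : StrictlyUnimodal (gTwo p₁ p₂)) : (p₁, p₂) ∈ setB := by
  rcases le_total (p₁ + p₂) 1 with hs | hs
  · exact mem_setB_of_strictlyUnimodal_of_le h₁ h₂ hs h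
  · exact mem_setB_one_sub.1 (mem_setB_of_strictlyUnimodal_of_le (one_sub_mem_Ioo h₁)
      (one_sub_mem_Ioo h₂) (by linarith) (strictlyUnimodal_gTwo_one_sub.2 h))

theorem setB_subset_setA : setB ⊆ setA := by
  rintro ⟨p₁, p₂⟩ h
  rcases id h with ⟨⟨h₁, h₂⟩, -⟩ | h' | h'
  · rcases le_total (p₁ + p₂) 1 with hs | hs
    · exact mem_setA_of_mem_setB_of_le h₁ h₂ hs h
    · exact mem_setA_one_sub.1 (mem_setA_of_mem_setB_of_le (one_sub_mem_Ioo h₁)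
        (one_sub_mem_Ioo h₂) (by linarith) (mem_setB_one_sub.2 h))
  · rw [h']
    norm_num [setA]
  · rw [mem_singleton_iff.1 h']
    norm_num [setA]

/-- The set `C`: the points of `B` at which `gTwo` is also strictly monotone between `0` and
`tStar`. -/
def setC : Set (ℝ × ℝ) :=
  {p | p ∈ setB ∧
    (p.1 + p.2 < 1 → ∀ t ∈ Ioo 0 (tStar p.1 p.2), 0 < deriv (gTwo p.1 p.2) t) ∧
    (1 < p.1 + p.2 → ∀ t ∈ Ioo (tStar p.1 p.2) 0, deriv (gTwo p.1 p.2) t < 0)}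

theorem strictlyUnimodal_iff_mem_setC (h₁ : p₁ ∈ Ioo (0 : ℝ) 1) (h₂ : p₂ ∈ Ioo (0 : ℝ) 1) :
    StrictlyUnimodal (gTwo p₁ p₂) ↔ (p₁, p₂) ∈ setC := by
  constructor
  · exact fun h => ⟨mem_setB_of_strictlyUnimodal h₁ h₂ h,
      fun hs => (deriv_gTwo_pos_iff_strictlyUnimodal h₁ h₂ hs).2 h,
      fun hs => (deriv_gTwo_neg_iff_strictlyUnimodal h₁ h₂ hs).2 h⟩
  · rintro ⟨hB, hlt, hgt⟩
    rcases lt_trichotomy (p₁ + p₂) 1 with hs | hs | hs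
    · exact (deriv_gTwo_pos_iff_strictlyUnimodal h₁ h₂ hs).1 (hlt hs)
    -- On the antidiagonal t* = 0, no middle interval remains, and membership in B controls both
    -- rays.
    · exact ⟨differentiable_gTwo (Ioo_subset_Icc h₁) (Ioo_subset_Icc h₂), tStar p₁ p₂,
        (deriv_gTwo_pos_left_iff_mem_setB h₁ h₂ hs.ge).2 hB,
        (deriv_gTwo_neg_right_iff_mem_setB h₁ h₂ hs.le).2 hB⟩
    · exact (deriv_gTwo_neg_iff_strictlyUnimodal h₁ h₂ hs).1 (hgt hs)

theorem deriv_gTwo_pos_iff_mem_setC (h₁ : p₁ ∈ Ioo (0 : ℝ) 1) (h₂ : p₂ ∈ Ioo (0 : ℝ) 1)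
    (hs : p₁ + p₂ < 1) :
    (∀ t ∈ Ioo 0 (tStar p₁ p₂), 0 < deriv (gTwo p₁ p₂) t) ↔ (p₁, p₂) ∈ setC :=
  (deriv_gTwo_pos_iff_strictlyUnimodal h₁ h₂ hs).trans (strictlyUnimodal_iff_mem_setC h₁ h₂)

theorem deriv_gTwo_neg_iff_mem_setC (h₁ : p₁ ∈ Ioo (0 : ℝ) 1) (h₂ : p₂ ∈ Ioo (0 : ℝ) 1)
    (hs : 1 < p₁ + p₂) :
    (∀ t ∈ Ioo (tStar p₁ p₂) 0, deriv (gTwo p₁ p₂) t < 0) ↔ (p₁, p₂) ∈ setC :=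
  (deriv_gTwo_neg_iff_strictlyUnimodal h₁ h₂ hs).trans (strictlyUnimodal_iff_mem_setC h₁ h₂)

end

theorem theorem2 :
    (∀ p₁ ∈ Ioo (0 : ℝ) 1, ∀ p₂ ∈ Ioo (0 : ℝ) 1,
      HasDerivAt (gTwo p₁ p₂) 0 (tStar p₁ p₂)) ∧
    ∃ C : Set (ℝ × ℝ),
      C ⊆ setB ∧ setB ⊆ setA ∧ setA ⊆ Icc (0 : ℝ) 1 ×ˢ Icc (0 : ℝ) 1 ∧
      -- (1), on the closed square without the two corners where `g` vanishes although `(p₁,p₂) ∈ A`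
      (∀ p₁ ∈ Icc (0 : ℝ) 1, ∀ p₂ ∈ Icc (0 : ℝ) 1, (p₁, p₂) ≠ (0, 0) → (p₁, p₂) ≠ (1, 1) →
        (p₁ + p₂ ≤ 1 → ((∀ t < 0, 0 < deriv (gTwo p₁ p₂) t) ↔ (p₁, p₂) ∈ setA)) ∧
        (1 ≤ p₁ + p₂ → ((∀ t > 0, deriv (gTwo p₁ p₂) t < 0) ↔ (p₁, p₂) ∈ setA))) ∧
      (∀ p₁ ∈ Ioo (0 : ℝ) 1, ∀ p₂ ∈ Ioo (0 : ℝ) 1,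
        -- (2)
        (p₁ + p₂ ≤ 1 →
          ((∀ t > tStar p₁ p₂, deriv (gTwo p₁ p₂) t < 0) ↔ (p₁, p₂) ∈ setB)) ∧
        (1 ≤ p₁ + p₂ →
          ((∀ t < tStar p₁ p₂, 0 < deriv (gTwo p₁ p₂) t) ↔ (p₁, p₂) ∈ setB)) ∧
        -- (3)
        (p₁ + p₂ < 1 →
          ((∀ t ∈ Ioo 0 (tStar p₁ p₂), 0 < deriv (gTwo p₁ p₂) t) ↔ (p₁, p₂) ∈ C)) ∧
        (1 < p₁ + p₂ →
          ((∀ t ∈ Ioo (tStar p₁ p₂) 0, deriv (gTwo p₁ p₂) t < 0) ↔ (p₁, p₂) ∈ C)) ∧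
        -- the final assertion
        (StrictlyUnimodal (gTwo p₁ p₂) ↔ (p₁, p₂) ∈ C)) := by
  exact ⟨fun p₁ h₁ p₂ h₂ => hasDerivAt_gTwo_tStar h₁ h₂, setC, fun p h => h.1, setB_subset_setA,
    fun p h => h.1, fun p₁ h₁ p₂ h₂ h0 h1 => ⟨deriv_gTwo_pos_left_iff_mem_setA h₁ h₂ h0,
      deriv_gTwo_neg_right_iff_mem_setA h₁ h₂ h1⟩,
    fun p₁ h₁ p₂ h₂ => ⟨deriv_gTwo_neg_right_iff_mem_setB h₁ h₂,
      deriv_gTwo_pos_left_iff_mem_setB h₁ h₂, deriv_gTwo_pos_iff_mem_setC h₁ h₂,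
      deriv_gTwo_neg_iff_mem_setC h₁ h₂, strictlyUnimodal_iff_mem_setC h₁ h₂⟩⟩
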